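/- For a group $G$ let $\mathrm{Core}_{RF}(G)$ be the intersection of all finite-index normal subgroups of $G$. Put $\mathrm{Core}_{RF}^0(G)=G$, $\mathrm{Core}_{RF}^{\alpha+1}(G)=\mathrm{Core}_{RF}(\mathrm{Core}_{RF}^{\alpha}(G))$, and $\mathrm{Core}_{RF}^{\lambda}(G)=\bigcap_{\beta<\lambda}\mathrm{Core}_{RF}^{\beta}(G)$ for limit ordinals $\lambda$. For an ordinal $\alpha$, the group $G$ is called $\alpha$-residually finite if there are subgroups $(G_\beta)_{\beta\le\alpha}$ of $G$ with $G_0=G$, $G_\alpha=\{1\}$, $G_\gamma\le G_\beta$ whenever $\beta<\gamma\le\alpha$, $[G_\beta:G_{\beta+1}]<\infty$ for all $\beta<\alpha$, and $G_\lambda=\bigcap_{\beta<\lambda}G_\beta$ for all limit ordinals $\lambda\le\alpha$. If such an $\alpha$ exists, $\mathrm{depth}(G)$ is the least one; otherwise $\mathrm{depth}(G)$ is undefined. **Lemma.** Let $\Gamma$ be a countable group that is the free product of a family of non-trivial subgroups $(A_i)_{i\in I}$. Then: 1. $A_i\cap \mathrm{Core}_{RF}^\alpha(\Gamma)=\mathrm{Core}_{RF}^\alpha(A_i)$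 for every ordinal $\alpha$ and every $i\in I$. 2. For every ordinal $\alpha$, $\mathrm{Core}_{RF}^\alpha(\Gamma)$ is a free product of copies of the groups $\mathrm{Core}_{RF}^\alpha(A_i)$: it is the free product of a family of subgroups $(B_j)_{j\in J}$ such that, for some surjection $f:J\to I$, $B_j\cong \mathrm{Core}_{RF}^\alpha(A_{f(j)})$ for all $j\in J$. Suppose moreover that $\mathrm{depth}(A_i)$ is defined for every $i\in I$, and let $\sigma=\sup_i\mathrm{depth}(A_i)$. 3. If $\sigma$ is a limit ordinal, then $\mathrm{depth}(\Gamma)$ is defined and equals $\sigma$. 4. If $\sigma$ is a successor ordinal and $I$ has at least two elements, then $\mathrm{depth}(\Gamma)$ is defined and equals $\sigma+\omega$. -/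

import Mathlib

universe u v w

/-- The residual core of `G`: the elements with trivial image in every finite quotient of `G`,
i.e. the intersection of all normal subgroups of finite index. -/
def rfCore (G : Type u) [Group G] : Subgroup G :=
  ⨅ N : FiniteIndexNormalSubgroup G, N.toSubgroup

/-- The transfinitely iterated residual core, as a subgroup of `G`: it is `G` at `0`, at `α + 1` it
is the residual core of the group obtained at `α`, and at limit ordinals it is the intersection of
the earlier terms. -/
noncomputable def iterCore (G : Type u) [Group G] (α : Ordinal.{w}) : Subgroup G :=
  Ordinal.limitRecOn (motive := fun _ => Subgroup G) α
    ⊤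
    (fun _ C => (rfCore C).map C.subtype)
    (fun a _ C => ⨅ (b : Ordinal.{w}) (h : b < a), C b h)

/-- `G` is `α`-residually finite. Only the values `F β` with `β ≤ α` matter. -/
def IsOrdinalRF (G : Type u) [Group G] (α : Ordinal.{w}) : Prop :=
  ∃ F : Ordinal.{w} → Subgroup G,
    F 0 = ⊤ ∧ F α = ⊥ ∧
    (∀ β γ, β < γ → γ ≤ α → F γ ≤ F β) ∧
    (∀ β, β < α → (F (β + 1)).IsFiniteRelIndex (F β)) ∧
    (∀ l, l ≤ α → Order.IsSuccLimit l → F l = ⨅ (β : Ordinal.{w}) (_ : β < l), F β)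

/-- The residual finiteness depth of `G` is defined and equal to `α`. -/
def HasRFDepth (G : Type u) [Group G] (α : Ordinal.{w}) : Prop :=
  IsLeast {β : Ordinal.{w} | IsOrdinalRF G β} α

/-- `G` is the (internal) free product of the subgroups `A i`: the canonical homomorphism from the
external free product is an isomorphism. -/
def IsFreeProductOf {G : Type u} [Group G] {ι : Type v} (A : ι → Subgroup G) : Prop :=
  Function.Bijective (Monoid.CoprodI.lift fun i => (A i).subtype)

/-! Call a normal subgroup `N` of the free product detected by letters (`HasLetterIn`) if it is the
kernel of the map to the free product of the quotients of the factors by their intersections with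
`N`. A Schreier transversal argument shows that such an `N` is a free product of conjugates of these
intersections (`HasLetterIn.bijective_subgroupFactor`). The residual core of a free product is
itself detected by letters: a reduced word whose letters all avoid the cores of the factors survives
in a free product of finite groups, which is residually finite. Applying this inside `N` passes
detection from `N` to its core, and transfinite induction gives assertions 1 and 2. For depth, a
countable group is `ω * α`-residually finite exactly when its `α`-th core is trivial
(`isOrdinalRF_omega0_mul_iff`). A limit `σ` has the form `ω * α`, and depth is monotone in
subgroups. If `σ = ω * α + m + 1`, some factor has nontrivial `α`-th core, so the `α`-th core of `Γ`
is infinite, whereas a depth below `ω * (α + 1) = σ + ω` would make it finite. -/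

open Monoid

/-! ### Truncated actions -/

section Truncated

open Classical in
/-- The action of `H` on a subset `Y` of an `H`-set that agrees with the given action on the orbits
contained in `Y` and is trivial on the other points. -/
noncomputable abbrev truncatedAction (H : Type*) {X : Type*} [Group H] [MulAction H X] (Y : Set X) :
    MulAction H Y where
  smul h y := if hy : ∀ k : H, k • (y : X) ∈ Y then ⟨h • (y : X), hy h⟩ else y
  one_smul y := by
    change dite _ _ _ = _
    split_ifs <;> simp
  mul_smul h k y := by
    by_cases hy : ∀ k : H, k • (y : X) ∈ Y
    · have hk : ∀ l : H, l • k • (y : X) ∈ Y := fun l => by rw [smul_smul]; exact hy _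
      refine (dif_pos hy).trans (Eq.symm ?_)
      change dite _ _ _ = _
      have e : (dite (∀ k : H, k • (y : X) ∈ Y) (fun hy => ⟨k • (y : X), hy k⟩) fun _ => y) =
        (⟨k • (y : X), hy k⟩ : Y) := dif_pos hy
      simp only [HSMul.hSMul, SMul.smul] at e hk ⊢
      simp only [e]
      exact (dif_pos hk).trans (Subtype.ext (mul_smul h k (y : X)).symm)
    · have e : (dite (∀ k : H, k • (y : X) ∈ Y) (fun hy => ⟨k • (y : X), hy k⟩) fun _ => y) = y :=
        dif_neg hy
      refine (dif_neg hy).trans (Eq.symm ?_)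
      change dite _ _ _ = _
      simp only [HSMul.hSMul, SMul.smul] at e hy ⊢
      simp only [e]
      exact dif_neg hy

/-- The permutation representation of the truncated action. -/
noncomputable def truncatedPerm (H : Type*) {X : Type*} [Group H] [MulAction H X] (Y : Set X) :
    H →* Equiv.Perm Y :=
  letI := truncatedAction H Y
  MulAction.toPermHom H Y

theorem truncatedPerm_apply {H X : Type*} [Group H] [MulAction H X] {Y : Set X} {y : Y}
    (hy : ∀ k : H, k • (y : X) ∈ Y) (h : H) :
    (truncatedPerm H Y h y : X) = h • (y : X) := by
  have : truncatedPerm H Y h y = ⟨h • (y : X), hy h⟩ := dif_pos hy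
  rw [this]

end Truncated

/-! ### Residual finiteness of free products of finite groups -/

section FiniteFactors

variable {ι : Type v} {F : ι → Type u} [∀ i, Group (F i)]

/-- The free product of the groups `F i`, acting on a subset of itself by truncated left
translations of the factors. -/
noncomputable def CoprodI.truncatedPerm (Y : Set (CoprodI F)) : CoprodI F →* Equiv.Perm Y :=
  CoprodI.lift fun i =>
    letI : MulAction (F i) (CoprodI F) := MulAction.compHom _ (CoprodI.of (i := i))
    _root_.truncatedPerm (F i) Y

/-- Each letter acts as honest translation once the whole orbit of the current suffix under its
factor lies in `Y`. These orbits are finite, and a word meets finitely many of them. -/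
theorem CoprodI.exists_finite_truncatedPerm [∀ i, Finite (F i)] (g : CoprodI F) :
    ∃ S : Set (CoprodI F), S.Finite ∧ ∀ Y, S ⊆ Y →
      ∃ h : 1 ∈ Y, (CoprodI.truncatedPerm Y g ⟨1, h⟩ : CoprodI F) = g := by
  induction g using CoprodI.induction_left with
  | one => exact ⟨{1}, by simp, fun Y hY => ⟨hY rfl, by simp⟩⟩
  | @mul i m x ih =>
    obtain ⟨S, hS, h⟩ := ih
    refine ⟨S ∪ Set.range fun f : F i => CoprodI.of f * x, hS.union (Set.finite_range _), ?_⟩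
    intro Y hY
    obtain ⟨h1, h2⟩ := h Y (Set.subset_union_left.trans hY)
    refine ⟨h1, ?_⟩
    rw [map_mul, Equiv.Perm.mul_apply]
    generalize CoprodI.truncatedPerm Y x ⟨1, h1⟩ = z at h2
    rw [CoprodI.truncatedPerm, CoprodI.lift_of]
    let : MulAction (F i) (CoprodI F) := MulAction.compHom _ (CoprodI.of (i := i))
    rw [truncatedPerm_apply]
    · rw [h2]; rfl
    · intro k
      rw [h2]
      exact hY (Or.inr ⟨k, rfl⟩)

theorem CoprodI.exists_hom_perm_ne_one [∀ i, Finite (F i)] {g : CoprodI F} (hg : g ≠ 1) :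
    ∃ (Y : Set (CoprodI F)) (_ : Y.Finite) (f : CoprodI F →* Equiv.Perm Y), f g ≠ 1 := by
  obtain ⟨S, hS, h⟩ := CoprodI.exists_finite_truncatedPerm g
  obtain ⟨h1, h2⟩ := h S subset_rfl
  refine ⟨S, hS, CoprodI.truncatedPerm S, fun h3 => hg ?_⟩
  rw [← h2, h3]
  rfl

end FiniteFactors

/-! ### The residual core and homomorphisms -/

section Core

variable {G : Type u} [Group G] {H : Type v} [Group H]

theorem mem_rfCore {g : G} : g ∈ rfCore G ↔ ∀ N : FiniteIndexNormalSubgroup G, g ∈ N := by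
  simp only [rfCore, Subgroup.mem_iInf]
  rfl

theorem map_eq_one_of_mem_rfCore [Finite H] (f : G →* H) {g : G} (hg : g ∈ rfCore G) :
    f g = 1 := by
  have : Finite (G ⧸ f.ker) := Finite.of_injective _ (QuotientGroup.kerLift_injective f)
  exact mem_rfCore.1 hg ⟨f.ker, inferInstance, Subgroup.finiteIndex_of_finite_quotient⟩

theorem rfCore_le_of_finiteIndex (K : Subgroup G) [K.FiniteIndex] : rfCore G ≤ K := fun _ hg =>
  K.normalCore_le (mem_rfCore.1 hg ⟨K.normalCore, inferInstance, inferInstance⟩)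

theorem map_mem_rfCore (f : G →* H) {g : G} (hg : g ∈ rfCore G) : f g ∈ rfCore H :=
  mem_rfCore.2 fun N => by
    have := map_eq_one_of_mem_rfCore (H := H ⧸ N.toSubgroup) ((QuotientGroup.mk' _).comp f) hg
    exact (QuotientGroup.eq_one_iff _).1 this

instance rfCore_characteristic : (rfCore G).Characteristic :=
  Subgroup.characteristic_iff_le_comap.2 fun e _ hg => map_mem_rfCore e.toMonoidHom hg

end Core

/-! ### Reduced words and detection by letters -/

section Words

variable {ι : Type v} {G : ι → Type u} [∀ i, Group (G i)]

/-- Apply homomorphisms letter by letter to a reduced word none of whose letters is killed. -/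
def wordMap {H : ι → Type w} [∀ i, Group (H i)] (f : ∀ i, G i →* H i) (w : CoprodI.Word G)
    (hw : ∀ l ∈ w.toList, f l.1 l.2 ≠ 1) : CoprodI.Word H where
  toList := w.toList.map fun l => ⟨l.1, f l.1 l.2⟩
  ne_one l hl := by
    obtain ⟨a, ha, rfl⟩ := List.mem_map.1 hl
    exact hw a ha
  chain_ne := by
    rw [List.isChain_map]
    exact w.chain_ne

theorem prod_wordMap {H : ι → Type w} [∀ i, Group (H i)] (f : ∀ i, G i →* H i)
    (w : CoprodI.Word G) (hw : ∀ l ∈ w.toList, f l.1 l.2 ≠ 1) :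
    (wordMap f w hw).prod = CoprodI.lift (fun i => CoprodI.of.comp (f i)) w.prod := by
  simp [CoprodI.Word.prod, wordMap, map_list_prod, Function.comp_def]

theorem prod_word_ne_one {w : CoprodI.Word G} (hw : w ≠ .empty) : w.prod ≠ 1 := by
  classical
  intro h
  exact hw (CoprodI.Word.equiv.symm.injective (h.trans CoprodI.Word.prod_empty.symm))

theorem lift_prod_ne_one {H : ι → Type w} [∀ i, Group (H i)] (f : ∀ i, G i →* H i)
    {w : CoprodI.Word G} (hne : w ≠ .empty) (hw : ∀ l ∈ w.toList, f l.1 l.2 ≠ 1) :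
    CoprodI.lift (fun i => CoprodI.of.comp (f i)) w.prod ≠ 1 := by
  rw [← prod_wordMap f w hw]
  refine prod_word_ne_one fun h => hne ?_
  have h2 := congrArg CoprodI.Word.toList h
  ext1
  simpa [wordMap] using h2

theorem exists_finiteIndexNormal_of_letters (L : List (Σ i, G i))
    (hL : ∀ l ∈ L, l.2 ∉ rfCore (G l.1)) :
    ∃ M : ∀ i, FiniteIndexNormalSubgroup (G i), ∀ l ∈ L, l.2 ∉ M l.1 := by
  classical
  induction L with
  | nil => exact ⟨fun i => ⟨⊤, inferInstance, inferInstance⟩, by simp⟩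
  | cons a L ih =>
    obtain ⟨M, hM⟩ := ih fun l hl => hL l (List.mem_cons_of_mem _ hl)
    have ha := hL a List.mem_cons_self
    rw [mem_rfCore] at ha
    push Not at ha
    obtain ⟨N, hN⟩ := ha
    have hle : ∀ i, Function.update M a.1 (M a.1 ⊓ N) i ≤ M i := by
      intro i
      by_cases hi : i = a.1
      · subst hi; simp
      · simp [Function.update_of_ne hi]
    refine ⟨Function.update M a.1 (M a.1 ⊓ N), fun l hl => ?_⟩
    rcases List.mem_cons.1 hl with rfl | hl
    · simp only [Function.update_self]
      exact fun h => hN ((inf_le_right : M l.1 ⊓ N ≤ N) h)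
    · exact fun h => hM l hl (hle _ h)

/-- Every nonempty reduced word with value in `N` has a letter in `N`. For normal `N` this says that
`N` is the kernel of the map to the free product of the quotients of the factors. -/
def HasLetterIn {Γ : Type w} [Group Γ] (φ : ∀ i, G i →* Γ) (N : Subgroup Γ) : Prop :=
  ∀ w : CoprodI.Word G, w ≠ .empty → CoprodI.lift φ w.prod ∈ N → ∃ l ∈ w.toList, φ l.1 l.2 ∈ N

variable {Γ : Type w} [Group Γ] {φ : ∀ i, G i →* Γ}

/-- If no letter lies in the core, finite quotients of the factors keep every letter alive; the
image word is nontrivial in a free product of finite groups, hence in some finite quotient. -/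
theorem hasLetterIn_map_rfCore (hφ : Function.Injective (CoprodI.lift φ)) :
    HasLetterIn φ ((rfCore (CoprodI G)).map (CoprodI.lift φ)) := by
  intro w hw hmem
  by_contra! hc
  obtain ⟨M, hM⟩ := exists_finiteIndexNormal_of_letters w.toList fun l hl h => hc l hl
    ⟨CoprodI.of l.2, map_mem_rfCore _ h, by simp⟩
  have hne := lift_prod_ne_one (fun i => QuotientGroup.mk' (M i).toSubgroup) hw
    fun l hl h => hM l hl ((QuotientGroup.eq_one_iff _).1 h)
  obtain ⟨Y, hY, f, hf⟩ := CoprodI.exists_hom_perm_ne_one hne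
  have := hY.to_subtype
  obtain ⟨g, hg, e⟩ := hmem
  rw [hφ e] at hg
  exact hf (map_eq_one_of_mem_rfCore (f.comp (CoprodI.lift _)) hg)

theorem rfCore_map_of_bijective {H K : Type*} [Group H] [Group K] {f : H →* K}
    (hf : Function.Bijective f) : (rfCore H).map f = rfCore K := by
  apply le_antisymm
  · rintro _ ⟨g, hg, rfl⟩
    exact map_mem_rfCore f hg
  · intro k hk
    refine ⟨(MulEquiv.ofBijective f hf).symm k, map_mem_rfCore
      (MulEquiv.ofBijective f hf).symm.toMonoidHom hk, ?_⟩
    exact (MulEquiv.ofBijective f hf).apply_symm_apply k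

theorem hasLetterIn_rfCore (hφ : Function.Bijective (CoprodI.lift φ)) :
    HasLetterIn φ (rfCore Γ) :=
  rfCore_map_of_bijective hφ ▸ hasLetterIn_map_rfCore hφ.1

theorem map_mem_rfCore_iff (hφ : Function.Bijective (CoprodI.lift φ)) {i : ι} {g : G i} :
    φ i g ∈ rfCore Γ ↔ g ∈ rfCore (G i) := by
  classical
  refine ⟨fun h => ?_, fun h => map_mem_rfCore _ h⟩
  have h1 : CoprodI.of g ∈ rfCore (CoprodI G) := by
    rw [← rfCore_map_of_bijective hφ] at h
    obtain ⟨x, hx, e⟩ := h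
    rw [← CoprodI.lift_of φ] at e
    rwa [← hφ.1 e]
  -- The retraction of the free product onto the factor `i` carries core to core.
  have := map_mem_rfCore (CoprodI.lift (Pi.mulSingle i (MonoidHom.id (G i)))) h1
  rwa [CoprodI.of_leftInverse] at this

/-- A product of `n` letters is the value of a reduced word of length at most `n`. -/
theorem exists_word_length_le (L : List (Σ i, G i)) :
    ∃ w : CoprodI.Word G, w.prod = (L.map fun l => CoprodI.of l.2).prod ∧
      w.toList.length ≤ L.length := by
  classical
  induction L with
  | nil => exact ⟨.empty, by simp⟩
  | cons a L ih =>
    obtain ⟨w, hw, hl⟩ := ih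
    refine ⟨CoprodI.of a.2 • w, by simp [hw], ?_⟩
    have key : ∀ p : CoprodI.Word.Pair G a.1, (CoprodI.Word.rcons p).toList.length ≤
        p.tail.toList.length + 1 ∧ p.tail.toList.length ≤ (CoprodI.Word.rcons p).toList.length := by
      intro p
      unfold CoprodI.Word.rcons
      split_ifs <;> simp
    have h1 := (key (CoprodI.Word.equivPair a.1 w)).2
    rw [← CoprodI.Word.equivPair_symm, Equiv.symm_apply_apply] at h1
    rw [CoprodI.Word.of_smul_def]
    have h2 := (key { CoprodI.Word.equivPair a.1 w with
      head := a.2 * (CoprodI.Word.equivPair a.1 w).head }).1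
    simp only [List.length_cons] at *
    omega

/-- A letter in `N` can be moved to the right end as a conjugate lying in `S`, leaving a shorter
product. What remains need not be reduced, so the induction runs over arbitrary lists and reduces
them at each step. -/
theorem HasLetterIn.mem_of_list {N S : Subgroup Γ} (hN : HasLetterIn φ N) [S.Normal]
    (hSN : S ≤ N) (hS : ∀ i g, φ i g ∈ N → φ i g ∈ S) (n : ℕ) (L : List (Σ i, G i))
    (hL : L.length ≤ n) (hmem : CoprodI.lift φ (L.map fun l => CoprodI.of l.2).prod ∈ N) :
    CoprodI.lift φ (L.map fun l => CoprodI.of l.2).prod ∈ S := by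
  induction n generalizing L with
  | zero =>
    obtain rfl : L = [] := by simpa using hL
    simp
  | succ n ih =>
    obtain ⟨w, hw, hlen⟩ := exists_word_length_le L
    rw [← hw] at hmem ⊢
    by_cases hne : w = .empty
    · simp [hne]
    obtain ⟨l, hl, hlN⟩ := hN w hne hmem
    obtain ⟨s, t, hst⟩ := List.append_of_mem hl
    have hlS := hS _ _ hlN
    have e : CoprodI.lift φ w.prod =
        CoprodI.lift φ ((s ++ t).map fun l => CoprodI.of l.2).prod *
        ((CoprodI.lift φ (t.map fun l => CoprodI.of l.2).prod)⁻¹ * φ l.1 l.2 *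
          CoprodI.lift φ (t.map fun l => CoprodI.of l.2).prod) := by
      simp only [CoprodI.Word.prod, hst, List.map_append, List.map_cons, List.prod_append,
        List.prod_cons, map_mul, CoprodI.lift_of]
      group
    have hc := (inferInstance : S.Normal).conj_mem' _ hlS
      (CoprodI.lift φ (t.map fun l => CoprodI.of l.2).prod)
    rw [e] at hmem ⊢
    refine S.mul_mem (ih _ ?_ ?_) hc
    · rw [hst] at hlen
      simp at hlen ⊢
      omega
    · exact (N.mul_mem_cancel_right (hSN hc)).1 hmem

/-- A normal subgroup detected by letters is contained in every normal subgroup `S` containing its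
intersections with the factors. -/
theorem HasLetterIn.le {N S : Subgroup Γ} (hφ : Function.Surjective (CoprodI.lift φ))
    (hN : HasLetterIn φ N) [N.Normal] [S.Normal] (hS : ∀ i g, φ i g ∈ N → φ i g ∈ S) : N ≤ S := by
  classical
  intro n hn
  obtain ⟨x, rfl⟩ := hφ n
  have e := CoprodI.Word.equiv.left_inv x
  change (CoprodI.Word.equiv x).prod = x at e
  rw [← e] at hn ⊢
  exact (hN.mem_of_list (S := S ⊓ N) inf_le_right (fun i g h => ⟨hS i g h, h⟩) _ _ le_rfl hn).1

/-- A normal subgroup generated by conjugates of elements of the factors is detected by letters. -/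
theorem HasLetterIn.of_le_normalClosure {N : Subgroup Γ}
    (hφ : Function.Bijective (CoprodI.lift φ)) [N.Normal]
    (h : N ≤ Subgroup.normalClosure {x | ∃ i g, φ i g ∈ N ∧ φ i g = x}) : HasLetterIn φ N := by
  intro w hw hmem
  by_contra! hc
  have hne := lift_prod_ne_one (fun i => QuotientGroup.mk' (N.comap (φ i))) hw
    fun l hl => by simpa using hc l hl
  set q := CoprodI.lift (M := G) fun i =>
    (CoprodI.of (M := fun i => G i ⧸ N.comap (φ i))).comp (QuotientGroup.mk' (N.comap (φ i))) with hq
  set e := MulEquiv.ofBijective _ hφ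
  have hle : N ≤ (q.comp e.symm.toMonoidHom).ker := by
    refine h.trans (Subgroup.normalClosure_le_normal ?_)
    rintro _ ⟨i, g, hg, rfl⟩
    have : e.symm (φ i g) = CoprodI.of g := by
      rw [MulEquiv.symm_apply_eq]
      simp [e]
    have h2 : QuotientGroup.mk' (N.comap (φ i)) g = 1 := by simpa using hg
    simp only [SetLike.mem_coe, MonoidHom.mem_ker, MonoidHom.comp_apply, MulEquiv.coe_toMonoidHom]
    rw [this, hq, CoprodI.lift_of, MonoidHom.comp_apply, h2, map_one]
  have h3 := hle hmem
  rw [MonoidHom.mem_ker, MonoidHom.comp_apply, MulEquiv.coe_toMonoidHom] at h3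
  rw [show e.symm (CoprodI.lift φ w.prod) = w.prod from e.symm_apply_apply _] at h3
  exact hne h3

end Words

/-! ### Free decomposition of the kernel by a Schreier transversal -/

section KernelStructure

open scoped Classical

variable {ι : Type v} {G : ι → Type u} [∀ i, Group (G i)] (R : ∀ i, Subgroup (G i))

/-- A transversal of `R i` in `G i` that represents the trivial coset by `1`. -/
noncomputable def cosetRep (i : ι) : G i ⧸ R i → G i :=
  Function.update Quotient.out ((1 : G i) : G i ⧸ R i) 1

@[simp]
theorem mk_cosetRep {i : ι} (q : G i ⧸ R i) : (cosetRep R i q : G i ⧸ R i) = q := by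
  unfold cosetRep
  by_cases h : q = ((1 : G i) : G i ⧸ R i)
  · subst h; simp
  · simp [Function.update_of_ne h]

variable [∀ i, (R i).Normal]

@[simp]
theorem cosetRep_one (i : ι) : cosetRep R i 1 = 1 := by
  unfold cosetRep
  exact Function.update_self _ _ _

/-- Reduced words in the free product of the quotients `G i ⧸ R i`. -/
abbrev QuotWord := CoprodI.Word fun i => G i ⧸ R i

/-- The value in `CoprodI G` of the word of coset representatives. -/
noncomputable def wordRep (w : QuotWord R) : CoprodI G :=
  (w.toList.map fun l => CoprodI.of (cosetRep R l.1 l.2)).prod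

@[simp]
theorem wordRep_empty : wordRep R .empty = 1 := rfl

theorem wordRep_cons {i : ι} (q : G i ⧸ R i) (w : QuotWord R) (h1 h2) :
    wordRep R (.cons q w h1 h2) = CoprodI.of (cosetRep R i q) * wordRep R w := by
  simp [wordRep, CoprodI.Word.cons]

theorem wordRep_rcons {i : ι} (p : CoprodI.Word.Pair (fun i => G i ⧸ R i) i) :
    wordRep R (CoprodI.Word.rcons p) = CoprodI.of (cosetRep R i p.head) * wordRep R p.tail := by
  unfold CoprodI.Word.rcons
  split_ifs with h
  · simp [h]
  · exact wordRep_cons R _ _ _ _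

/-- The words of coset representatives, which form a transversal of the left cosets of the kernel of
`CoprodI G → CoprodI (G ⧸ R)`, not starting in a given factor. -/
abbrev KernelIndex := Σ i : ι, {w : QuotWord R // w.fstIdx ≠ some i}

/-- The free product of the free factors of the kernel. -/
abbrev KernelCoprod := CoprodI fun j : KernelIndex R => R j.1

/-- The embedding of a free factor of the kernel, by conjugation. -/
noncomputable def kernelFactor (j : KernelIndex R) : R j.1 →* CoprodI G :=
  (MulAut.conj (wordRep R j.2.1)⁻¹).toMonoidHom.comp (CoprodI.of.comp (R j.1).subtype)

theorem kernelFactor_apply (j : KernelIndex R) (c : R j.1) :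
    kernelFactor R j c =
      (wordRep R j.2.1)⁻¹ * CoprodI.of (c : G j.1) * wordRep R j.2.1 := by
  simp [kernelFactor]

/-- The Schreier cocycle: left translation by `a` moves the coset of `p` to the coset of
`a • p`, and this is the resulting element of the kernel. -/
noncomputable def schreierCocycle {i : ι} (a : G i)
    (p : CoprodI.Word.Pair (fun i => G i ⧸ R i) i) : KernelCoprod R :=
  CoprodI.of (M := fun j : KernelIndex R => R j.1) (i := ⟨i, p.tail, p.fstIdx_ne⟩)
    ⟨(cosetRep R i ((a : G i ⧸ R i) * p.head))⁻¹ * a * cosetRep R i p.head, by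
      rw [← QuotientGroup.eq_one_iff]
      simp⟩

theorem schreierCocycle_one {i : ι} (p : CoprodI.Word.Pair (fun i => G i ⧸ R i) i) :
    schreierCocycle R 1 p = 1 := by
  rw [schreierCocycle, ← map_one CoprodI.of]
  congr 1
  ext
  simp

theorem schreierCocycle_mul {i : ι} (a b : G i) (p : CoprodI.Word.Pair (fun i => G i ⧸ R i) i) :
    schreierCocycle R (a * b) p =
      schreierCocycle R a ⟨(b : G i ⧸ R i) * p.head, p.tail, p.fstIdx_ne⟩ *
        schreierCocycle R b p := by
  rw [schreierCocycle, schreierCocycle, schreierCocycle, ← map_mul]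
  congr 1
  ext
  simp [mul_assoc]

/-- The action of a factor on words of coset representatives times the kernel. -/
noncomputable abbrev schreierAction (i : ι) : MulAction (G i) (QuotWord R × KernelCoprod R) where
  smul a x := (CoprodI.of (M := fun i => G i ⧸ R i) (a : G i ⧸ R i) • x.1,
    schreierCocycle R a (CoprodI.Word.equivPair i x.1) * x.2)
  one_smul x := by
    change (_, _) = _
    simp [schreierCocycle_one]
  mul_smul a b x := by
    refine Prod.ext ?_ ?_
    · change CoprodI.of (M := fun i => G i ⧸ R i) ((a * b : G i) : G i ⧸ R i) • x.1 =
        CoprodI.of (M := fun i => G i ⧸ R i) (a : G i ⧸ R i) •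
          CoprodI.of (M := fun i => G i ⧸ R i) (b : G i ⧸ R i) • x.1
      rw [smul_smul, ← map_mul, QuotientGroup.mk_mul]
    · change schreierCocycle R (a * b) _ * x.2 = schreierCocycle R a (CoprodI.Word.equivPair i
        (CoprodI.of (M := fun i => G i ⧸ R i) (b : G i ⧸ R i) • x.1)) *
          (schreierCocycle R b _ * x.2)
      rw [CoprodI.Word.equivPair_smul_same, schreierCocycle_mul, mul_assoc]

/-- The action of the free product on words of coset representatives times the kernel. -/
noncomputable def schreierPerm : CoprodI G →* Equiv.Perm (QuotWord R × KernelCoprod R) :=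
  CoprodI.lift fun i =>
    letI := schreierAction R i
    MulAction.toPermHom (G i) _

theorem schreierPerm_of {i : ι} (a : G i) (x : QuotWord R × KernelCoprod R) :
    schreierPerm R (CoprodI.of a) x =
      (CoprodI.of (M := fun i => G i ⧸ R i) (a : G i ⧸ R i) • x.1,
        schreierCocycle R a (CoprodI.Word.equivPair i x.1) * x.2) := by
  rw [schreierPerm, CoprodI.lift_of]
  rfl

/-- A pair `(w, k)` encodes the product of its transversal element and its kernel element; under
this encoding the action is left translation. -/
theorem schreierPerm_value (g : CoprodI G) (x : QuotWord R × KernelCoprod R) :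
    wordRep R (schreierPerm R g x).1 * CoprodI.lift (kernelFactor R) (schreierPerm R g x).2 =
      g * (wordRep R x.1 * CoprodI.lift (kernelFactor R) x.2) := by
  induction g using CoprodI.induction_left generalizing x with
  | one => simp
  | @mul i a g ih =>
    rw [map_mul, Equiv.Perm.mul_apply, mul_assoc, ← ih]
    generalize schreierPerm R g x = y
    rw [schreierPerm_of]
    have e := wordRep_rcons R (CoprodI.Word.equivPair i y.1)
    rw [← CoprodI.Word.equivPair_symm, Equiv.symm_apply_apply] at e
    rw [CoprodI.Word.of_smul_def, wordRep_rcons, e, map_mul, schreierCocycle, CoprodI.lift_of,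
      kernelFactor_apply]
    simp only [map_mul, map_inv]
    group

/-- Since the trivial coset is represented by `1`, the cocycle vanishes while a transversal word is
being built up. -/
theorem schreierPerm_wordRep (w : QuotWord R) (k : KernelCoprod R) :
    schreierPerm R (wordRep R w) (.empty, k) = (w, k) := by
  induction w using CoprodI.Word.consRecOn with
  | empty => simp
  | cons i q w h1 h2 ih =>
    rw [wordRep_cons, map_mul, Equiv.Perm.mul_apply, ih, schreierPerm_of,
      CoprodI.Word.equivPair_eq_of_fstIdx_ne h1, mk_cosetRep, ← CoprodI.Word.cons_eq_smul (h1 := h1)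
      (h2 := h2)]
    ext1
    · rfl
    · have : schreierCocycle R (cosetRep R i q) ⟨1, w, h1⟩ = 1 := by
        rw [schreierCocycle, ← map_one CoprodI.of]
        congr 1
        ext
        simp
      simp [this]

theorem schreierPerm_lift (k k' : KernelCoprod R) :
    schreierPerm R (CoprodI.lift (kernelFactor R) k) (.empty, k') = (.empty, k * k') := by
  induction k using CoprodI.induction_left with
  | one => simp
  | @mul j c k ih =>
    rw [map_mul, map_mul, Equiv.Perm.mul_apply, ih, CoprodI.lift_of, kernelFactor_apply, map_mul,
      map_mul, Equiv.Perm.mul_apply, Equiv.Perm.mul_apply, schreierPerm_wordRep, map_inv,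
      Equiv.Perm.inv_eq_iff_eq, schreierPerm_wordRep, schreierPerm_of,
      CoprodI.Word.equivPair_eq_of_fstIdx_ne j.2.2]
    have h1 : ((c : G j.1) : G j.1 ⧸ R j.1) = 1 := (QuotientGroup.eq_one_iff _).2 c.2
    ext1
    · simp [h1]
    · have : schreierCocycle R (c : G j.1) ⟨1, j.2.1, j.2.2⟩ =
          CoprodI.of (M := fun j : KernelIndex R => R j.1) (i := j) c := by
        rw [schreierCocycle]
        congr 1
        ext
        simp [h1]
      simp [this, mul_assoc]

theorem lift_kernelFactor_injective : Function.Injective (CoprodI.lift (kernelFactor R)) := by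
  intro k k' h
  have h1 := schreierPerm_lift R k 1
  rw [h, schreierPerm_lift] at h1
  simpa using (congrArg Prod.snd h1).symm

theorem exists_wordRep_mul (g : CoprodI G) :
    ∃ (w : QuotWord R) (k : KernelCoprod R), g = wordRep R w * CoprodI.lift (kernelFactor R) k :=
  ⟨_, _, by simpa using (schreierPerm_value R g (.empty, 1)).symm⟩

end KernelStructure

/-! ### Normal subgroups detected by letters and their cores -/

section Detected

variable {ι : Type v} {G : ι → Type u} [∀ i, Group (G i)] {Γ : Type w} [Group Γ]
  {φ : ∀ i, G i →* Γ} {N : Subgroup Γ} [N.Normal]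

/-- The embeddings of the free factors of a normal subgroup detected by letters. -/
noncomputable def subgroupFactor (φ : ∀ i, G i →* Γ) (N : Subgroup Γ) [N.Normal]
    (j : KernelIndex fun i => N.comap (φ i)) : N.comap (φ j.1) →* N :=
  ((CoprodI.lift φ).comp (kernelFactor _ j)).codRestrict N fun c => by
    simp only [MonoidHom.comp_apply, kernelFactor_apply, map_mul, map_inv, CoprodI.lift_of]
    exact Subgroup.Normal.conj_mem' (inferInstance : N.Normal) _ c.2 _

theorem coe_subgroupFactor (j : KernelIndex fun i => N.comap (φ i)) (c : N.comap (φ j.1)) :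
    (subgroupFactor φ N j c : Γ) = (CoprodI.lift φ (wordRep _ j.2.1))⁻¹ * φ j.1 c *
      CoprodI.lift φ (wordRep _ j.2.1) := by
  simp [subgroupFactor, kernelFactor_apply]

theorem coe_lift_subgroupFactor (k : KernelCoprod fun i => N.comap (φ i)) :
    (CoprodI.lift (subgroupFactor φ N) k : Γ) =
      CoprodI.lift φ (CoprodI.lift (kernelFactor fun i => N.comap (φ i)) k) := by
  have : N.subtype.comp (CoprodI.lift (subgroupFactor φ N)) =
      (CoprodI.lift φ).comp (CoprodI.lift (kernelFactor fun i => N.comap (φ i))) := by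
    refine CoprodI.ext_hom _ _ fun j => ?_
    ext c
    simp [subgroupFactor]
  exact DFunLike.congr_fun this k

/-- A normal subgroup detected by letters is a free product of conjugates of its intersections with
the factors. -/
theorem HasLetterIn.bijective_subgroupFactor (hφ : Function.Bijective (CoprodI.lift φ))
    (hN : HasLetterIn φ N) : Function.Bijective (CoprodI.lift (subgroupFactor φ N)) := by
  constructor
  · intro k k' h
    apply lift_kernelFactor_injective
    apply hφ.1
    rw [← coe_lift_subgroupFactor, ← coe_lift_subgroupFactor, h]
  · rintro ⟨n, hn⟩
    obtain ⟨g, rfl⟩ := hφ.2 n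
    obtain ⟨w, k, rfl⟩ := exists_wordRep_mul (fun i => N.comap (φ i)) g
    refine ⟨k, Subtype.ext ?_⟩
    rw [coe_lift_subgroupFactor]
    -- Otherwise the coset representatives form a nonempty reduced word with value in `N` and no
    -- letter in `N`.
    suffices w = .empty by simp [this]
    by_contra hw
    rw [map_mul, ← coe_lift_subgroupFactor] at hn
    have hw' := (N.mul_mem_cancel_right (CoprodI.lift (subgroupFactor φ N) k).2).1 hn
    let w' : CoprodI.Word G :=
      { toList := w.toList.map fun l => ⟨l.1, cosetRep (fun i => N.comap (φ i)) l.1 l.2⟩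
        ne_one := by
          intro l hl h
          obtain ⟨a, ha, rfl⟩ := List.mem_map.1 hl
          refine w.ne_one a ha ?_
          rw [← mk_cosetRep (fun i => N.comap (φ i)) a.2, QuotientGroup.eq_one_iff]
          exact (congrArg (· ∈ N.comap (φ a.1)) h).mpr (Subgroup.one_mem _)
        chain_ne := by
          rw [List.isChain_map]
          exact w.chain_ne }
    have e : w'.prod = wordRep _ w := by
      simp [CoprodI.Word.prod, wordRep, w', Function.comp_def]
    rw [← e] at hw'
    obtain ⟨l, hl, hlN⟩ := hN w' (fun h => hw (by
      ext1
      have h2 := congrArg CoprodI.Word.toList h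
      simpa [w'] using h2)) hw'
    obtain ⟨a, ha, rfl⟩ := List.mem_map.1 hl
    refine w.ne_one a ha ?_
    rw [← mk_cosetRep (fun i => N.comap (φ i)) a.2, QuotientGroup.eq_one_iff]
    exact hlN

/-- The intersection of the residual core of a normal subgroup detected by letters with a factor. -/
theorem HasLetterIn.mem_map_rfCore_iff (hφ : Function.Bijective (CoprodI.lift φ))
    (hN : HasLetterIn φ N) {i : ι} {g : G i} :
    φ i g ∈ (rfCore N).map N.subtype ↔
      g ∈ (rfCore (N.comap (φ i))).map (N.comap (φ i)).subtype := by
  have hb := hN.bijective_subgroupFactor hφ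
  -- The empty word indexes the unconjugated intersection with the factor `i`.
  let j : KernelIndex fun i => N.comap (φ i) := ⟨i, .empty, by simp [CoprodI.Word.fstIdx]⟩
  have key (c : N.comap (φ i)) : (subgroupFactor φ N j c : Γ) = φ i c := by
    simp [coe_subgroupFactor, j]
  constructor
  · rintro ⟨n, hn, e⟩
    have hg : g ∈ N.comap (φ i) := by
      rw [Subgroup.mem_comap, ← e]
      exact n.2
    refine ⟨⟨g, hg⟩, ?_, rfl⟩
    refine (map_mem_rfCore_iff hb (i := j)).1 ?_
    rwa [show subgroupFactor φ N j ⟨g, hg⟩ = n from Subtype.ext ((key _).trans e.symm)]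
  · rintro ⟨c, hc, rfl⟩
    exact ⟨subgroupFactor φ N j c, (map_mem_rfCore_iff hb (i := j)).2 hc, key c⟩

instance map_rfCore_normal : ((rfCore N).map N.subtype).Normal :=
  ConjAct.normal_of_characteristic_of_normal

/-- Detection by letters passes to the residual core. -/
theorem HasLetterIn.map_rfCore (hφ : Function.Bijective (CoprodI.lift φ))
    (hN : HasLetterIn φ N) : HasLetterIn φ ((rfCore N).map N.subtype) := by
  have hb := hN.bijective_subgroupFactor hφ
  apply HasLetterIn.of_le_normalClosure hφ
  set S := Subgroup.normalClosure
    {x | ∃ i g, φ i g ∈ (rfCore N).map N.subtype ∧ φ i g = x}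
  have hle : rfCore N ≤ S.subgroupOf N := by
    -- Detection with respect to the free decomposition of `N` itself, whose factors are conjugate
    -- into those of `Γ`.
    refine (hasLetterIn_rfCore hb).le hb.2 fun j c hc => ?_
    rw [Subgroup.mem_subgroupOf, coe_subgroupFactor]
    have : φ j.1 c ∈ S := Subgroup.subset_normalClosure ⟨j.1, c, ?_, rfl⟩
    · exact Subgroup.Normal.conj_mem' inferInstance _ this _
    exact (hN.mem_map_rfCore_iff hφ).2 ⟨c, (map_mem_rfCore_iff hb).1 hc, rfl⟩
  rintro _ ⟨n, hn, rfl⟩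
  exact hle hn

end Detected

/-! ### Basic properties of the iterated core -/

section IterCore

variable {G : Type u} [Group G]

theorem iterCore_zero : iterCore G (0 : Ordinal.{w}) = ⊤ :=
  Ordinal.limitRecOn_zero ..

theorem iterCore_add_one (α : Ordinal.{w}) :
    iterCore G (α + 1) = (rfCore (iterCore G α)).map (iterCore G α).subtype :=
  Ordinal.limitRecOn_add_one ..

theorem iterCore_limit {α : Ordinal.{w}} (h : Order.IsSuccLimit α) :
    iterCore G α = ⨅ (β : Ordinal.{w}) (_ : β < α), iterCore G β :=
  Ordinal.limitRecOn_limit _ _ _ _ h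

theorem iterCore_antitone : Antitone (iterCore G : Ordinal.{w} → Subgroup G) := by
  intro α β h
  induction β using Ordinal.limitRecOn with
  | zero => rw [nonpos_iff_eq_zero.1 h]
  | add_one β ih =>
    rcases h.eq_or_lt with rfl | h
    · rfl
    · rw [iterCore_add_one]
      exact (Subgroup.map_subtype_le _).trans (ih (Order.lt_add_one_iff.1 h))
  | limit β hβ ih =>
    rcases h.eq_or_lt with rfl | h
    · rfl
    · rw [iterCore_limit hβ]
      exact iInf₂_le α h

instance iterCore_normal (α : Ordinal.{w}) : (iterCore G α).Normal := by
  induction α using Ordinal.limitRecOn with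
  | zero => rw [iterCore_zero]; infer_instance
  | add_one α ih => rw [iterCore_add_one]; infer_instance
  | limit α h ih =>
    rw [iterCore_limit h]
    exact Subgroup.normal_iInf_normal fun β => Subgroup.normal_iInf_normal fun hβ => ih β hβ

end IterCore

/-! ### Iterated cores of free products -/

section FreeProduct

variable {ι : Type v} {G : ι → Type u} [∀ i, Group (G i)] {Γ : Type w} [Group Γ]
  {φ : ∀ i, G i →* Γ}

/-- Detection by letters passes to intersections of chains indexed by a limit ordinal. -/
theorem HasLetterIn.iInf_limit {α : Ordinal} (hα : Order.IsSuccLimit α)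
    {F : Ordinal → Subgroup Γ} (hF : Antitone F) (h : ∀ β < α, HasLetterIn φ (F β)) :
    HasLetterIn φ (⨅ (β) (_ : β < α), F β) := by
  intro w hw hmem
  by_contra! hc
  -- A word has finitely many letters, so a single stage below the limit already excludes all of
  -- them.
  have key : ∀ L : List (Σ i, G i), (∀ l ∈ L, φ l.1 l.2 ∉ ⨅ (β) (_ : β < α), F β) →
      ∃ β < α, ∀ l ∈ L, φ l.1 l.2 ∉ F β := by
    intro L
    induction L with
    | nil => exact fun _ => ⟨0, hα.bot_lt, by simp⟩
    | cons a L ih =>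
      intro hL
      obtain ⟨β, hβ, h1⟩ := ih fun l hl => hL l (List.mem_cons_of_mem _ hl)
      have ha := hL a List.mem_cons_self
      simp only [Subgroup.mem_iInf, not_forall] at ha
      obtain ⟨γ, hγ, h2⟩ := ha
      refine ⟨max β γ, max_lt hβ hγ, fun l hl => ?_⟩
      rcases List.mem_cons.1 hl with rfl | hl
      · exact fun h3 => h2 (hF (le_max_right _ _) h3)
      · exact fun h3 => h1 l hl (hF (le_max_left _ _) h3)
  obtain ⟨β, hβ, h1⟩ := key _ hc
  simp only [Subgroup.mem_iInf] at hmem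
  obtain ⟨l, hl, h2⟩ := h β hβ w hw (hmem β hβ)
  exact h1 l hl h2

/-- The two claims are proved together: at successors, computing the intersections with the factors
uses detection at the previous stage. -/
theorem hasLetterIn_iterCore_and_comap_eq (hφ : Function.Bijective (CoprodI.lift φ))
    (α : Ordinal) :
    HasLetterIn φ (iterCore Γ α) ∧ ∀ i, (iterCore Γ α).comap (φ i) = iterCore (G i) α := by
  induction α using Ordinal.limitRecOn with
  | zero =>
    simp only [iterCore_zero]
    refine ⟨fun w hw _ => ?_, fun i => rfl⟩
    obtain ⟨l, hl⟩ := List.exists_mem_of_ne_nil w.toList fun h => hw (CoprodI.Word.ext h)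
    exact ⟨l, hl, trivial⟩
  | add_one α ih =>
    simp only [iterCore_add_one]
    refine ⟨ih.1.map_rfCore hφ, fun i => ?_⟩
    ext g
    rw [Subgroup.mem_comap, ih.1.mem_map_rfCore_iff hφ, ih.2 i]
  | limit α h ih =>
    simp only [iterCore_limit h]
    refine ⟨HasLetterIn.iInf_limit h iterCore_antitone fun β hβ => (ih β hβ).1, fun i => ?_⟩
    simp only [Subgroup.comap_iInf]
    exact iInf_congr fun β => iInf_congr fun hβ => (ih β hβ).2 i

theorem factor_injective (hφ : Function.Injective (CoprodI.lift φ)) (i : ι) :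
    Function.Injective (φ i) := by
  have := hφ.comp (CoprodI.of_injective (M := G) i)
  simpa [Function.comp_def] using this

theorem isFreeProductOf_range (hφ : Function.Bijective (CoprodI.lift φ)) :
    IsFreeProductOf fun i => (φ i).range := by
  set q : CoprodI G →* CoprodI fun i => (φ i).range :=
    CoprodI.lift fun i => CoprodI.of.comp (φ i).rangeRestrict with hq
  have hq_surj : Function.Surjective q := by
    rw [← MonoidHom.range_eq_top, eq_top_iff]
    intro x _
    induction x using CoprodI.induction_left with
    | one => exact one_mem _
    | @mul i m x ih =>
      obtain ⟨_, a, rfl⟩ := m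
      exact mul_mem ⟨CoprodI.of a, by rw [hq, CoprodI.lift_of]; rfl⟩ (ih trivial)
  have hcomp : (CoprodI.lift fun i => (φ i).range.subtype).comp q = CoprodI.lift φ := by
    refine CoprodI.ext_hom _ _ fun i => ?_
    ext a
    simp [q]
  have hfun : (CoprodI.lift fun i => (φ i).range.subtype) ∘ q = CoprodI.lift φ :=
    congrArg DFunLike.coe hcomp
  have hq_inj : Function.Injective q := by
    refine Function.Injective.of_comp (f := CoprodI.lift fun i => (φ i).range.subtype) ?_
    rw [hfun]
    exact hφ.1
  rw [IsFreeProductOf, ← Function.Bijective.of_comp_iff _ ⟨hq_inj, hq_surj⟩, hfun]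
  exact hφ

end FreeProduct

/-! ### The first two assertions -/

section Subgroups

variable {Γ : Type u} [Group Γ] {ι : Type v} {A : ι → Subgroup Γ}

theorem inf_iterCore_eq (hfree : IsFreeProductOf A) (α : Ordinal.{w}) (i : ι) :
    A i ⊓ iterCore Γ α = (iterCore (A i) α).map (A i).subtype := by
  rw [← (hasLetterIn_iterCore_and_comap_eq hfree α).2 i, Subgroup.map_comap_eq,
    Subgroup.range_subtype]

theorem iterCore_isFreeProductOf (hfree : IsFreeProductOf A) (α : Ordinal.{w}) :
    ∃ (J : Type (max u v)) (f : J → ι) (B : J → Subgroup (iterCore Γ α)),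
      Function.Surjective f ∧ IsFreeProductOf B ∧
      ∀ j, Nonempty (B j ≃* iterCore (A (f j)) α) := by
  obtain ⟨h1, h2⟩ := hasLetterIn_iterCore_and_comap_eq hfree α
  have hb := h1.bijective_subgroupFactor hfree
  refine ⟨KernelIndex fun i => (iterCore Γ α).comap (A i).subtype, fun j => j.1,
    fun j => (subgroupFactor _ _ j).range, fun i => ⟨⟨i, .empty, nofun⟩, rfl⟩,
    isFreeProductOf_range hb, fun j => ⟨?_⟩⟩
  exact (MonoidHom.ofInjective (factor_injective hb.1 j)).symm.trans
    (MulEquiv.subgroupCongr (h2 j.1))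

theorem iterCore_eq_bot (hfree : IsFreeProductOf A) {α : Ordinal.{w}}
    (h : ∀ i, iterCore (A i) α = ⊥) : iterCore Γ α = ⊥ := by
  obtain ⟨h1, h2⟩ := hasLetterIn_iterCore_and_comap_eq hfree α
  rw [eq_bot_iff]
  refine h1.le hfree.2 fun i g hg => ?_
  have : g ∈ iterCore (A i) α := by rw [← h2]; exact hg
  rw [h, Subgroup.mem_bot] at this
  simp [this]

end Subgroups

/-! ### Finite-index chains compared with iterated cores -/

section Chains

variable {G : Type u} [Group G]

/-- A continuous descending chain of subgroups, indexed by all ordinals, with finite-index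
successor steps. -/
structure IsFiniteIndexChain (F : Ordinal.{w} → Subgroup G) : Prop where
  antitone : Antitone F
  zero : F 0 = ⊤
  add_one : ∀ β, (F (β + 1)).IsFiniteRelIndex (F β)
  limit : ∀ l, Order.IsSuccLimit l → F l = ⨅ (β : Ordinal.{w}) (_ : β < l), F β

theorem isOrdinalRF_iff {α : Ordinal.{w}} :
    IsOrdinalRF G α ↔ ∃ F : Ordinal.{w} → Subgroup G, IsFiniteIndexChain F ∧ F α = ⊥ := by
  constructor
  · rintro ⟨F, h0, hα, hF, hs, hl⟩
    have hanti : ∀ β γ, β ≤ γ → γ ≤ α → F γ ≤ F β := fun β γ h h' => by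
      rcases h.eq_or_lt with rfl | h
      · rfl
      · exact hF _ _ h h'
    have hm : Antitone fun β => F (min β α) := fun β γ h =>
      hanti _ _ (min_le_min_right _ h) (min_le_right _ _)
    -- The chain is frozen from `α` on.
    refine ⟨fun β => F (min β α), ⟨hm, by simpa using h0, fun β => ?_, fun l hl' => ?_⟩, by simpa⟩
    · rcases lt_or_ge β α with h | h
      · rw [min_eq_left (Order.add_one_le_of_lt h), min_eq_left h.le]
        exact hs β h
      · rw [min_eq_right h, min_eq_right (h.trans le_self_add)]
        exact ⟨by simp⟩
    · refine le_antisymm (le_iInf₂ fun β hβ => hm hβ.le) ?_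
      rcases le_or_gt l α with h | h
      · rw [min_eq_left h, hl l h hl']
        refine le_iInf₂ fun β hβ => (iInf₂_le β hβ).trans_eq ?_
        rw [min_eq_left (hβ.le.trans h)]
      · refine (iInf₂_le α h).trans_eq ?_
        rw [min_self, min_eq_right h.le]
  · rintro ⟨F, hF, hα⟩
    exact ⟨F, hF.zero, hα, fun _ _ h _ => hF.antitone h.le, fun β _ => hF.add_one β,
      fun l _ => hF.limit l⟩

theorem IsOrdinalRF.mono {α β : Ordinal.{w}} (h : IsOrdinalRF G α) (hαβ : α ≤ β) :
    IsOrdinalRF G β := by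
  rw [isOrdinalRF_iff] at *
  obtain ⟨F, hF, hα⟩ := h
  exact ⟨F, hF, eq_bot_iff.2 (hα ▸ hF.antitone hαβ)⟩

theorem IsOrdinalRF.subgroup {α : Ordinal.{w}} (h : IsOrdinalRF G α) (H : Subgroup G) :
    IsOrdinalRF H α := by
  rw [isOrdinalRF_iff] at *
  obtain ⟨F, hF, hα⟩ := h
  refine ⟨fun β => (F β).subgroupOf H, ⟨fun β γ h => Subgroup.comap_mono (hF.antitone h), ?_,
    fun β => ?_, fun l hl => ?_⟩, ?_⟩
  · rw [hF.zero]; rfl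
  · have := hF.add_one β
    have h2 : (F (β + 1)).IsFiniteRelIndex (((F β).subgroupOf H).map H.subtype) :=
      Subgroup.isFiniteRelIndex_of_le_right (L := F β) _
        ((Subgroup.subgroupOf_map_subtype _ _).trans_le inf_le_left)
    exact ⟨by rw [Subgroup.subgroupOf, Subgroup.relIndex_comap]; exact h2.relIndex_ne_zero⟩
  · rw [hF.limit l hl]
    simp only [Subgroup.subgroupOf, Subgroup.comap_iInf]
  · simp only [hα, Subgroup.bot_subgroupOf]

namespace IsFiniteIndexChain

variable {F : Ordinal.{w} → Subgroup G}

theorem add_natCast (hF : IsFiniteIndexChain F) (β : Ordinal.{w}) (n : ℕ) :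
    (F (β + n)).relIndex (F β) ≠ 0 := by
  induction n with
  | zero => simp
  | succ n ih =>
    rw [Nat.cast_succ, ← add_assoc]
    exact Subgroup.relIndex_ne_zero_trans (hF.add_one _).relIndex_ne_zero ih

/-- The terms `F (ω * α + n)` have finite index in `F (ω * α)`, so they cut out finite-index
subgroups of the `α`-th core, each containing the next core. -/
theorem iterCore_le (hF : IsFiniteIndexChain F) (α : Ordinal.{w}) :
    iterCore G α ≤ F (Ordinal.omega0 * α) := by
  induction α using Ordinal.limitRecOn with
  | zero => simp [hF.zero]
  | add_one α ih =>
    rw [mul_add_one, hF.limit _ (Ordinal.isSuccLimit_add _ Ordinal.isSuccLimit_omega0)]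
    refine le_iInf₂ fun β hβ => ?_
    obtain ⟨γ, hγ, hle⟩ := (Ordinal.lt_add_iff Ordinal.omega0_ne_zero).1 hβ
    obtain ⟨n, rfl⟩ := Ordinal.lt_omega0.1 hγ
    refine le_trans ?_ (hF.antitone hle)
    have h1 : (F (Ordinal.omega0 * α + n)).IsFiniteRelIndex (F (Ordinal.omega0 * α)) :=
      ⟨hF.add_natCast _ n⟩
    have h2 := Subgroup.isFiniteRelIndex_of_le_right (F (Ordinal.omega0 * α + n)) ih
    have h3 := rfCore_le_of_finiteIndex ((F (Ordinal.omega0 * α + n)).subgroupOf (iterCore G α))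
    rw [iterCore_add_one]
    exact Subgroup.map_le_iff_le_comap.2 h3
  | limit α hα ih =>
    rw [hF.limit _ (Ordinal.isSuccLimit_mul_right Ordinal.omega0_pos hα)]
    refine le_iInf₂ fun β hβ => ?_
    obtain ⟨γ, hγ, hlt⟩ := (Ordinal.lt_mul_iff_of_isSuccLimit hα).1 hβ
    exact ((iterCore_antitone hγ.le).trans (ih γ hγ)).trans (hF.antitone hlt.le)

end IsFiniteIndexChain

theorem IsOrdinalRF.iterCore_eq_bot {α : Ordinal.{w}} (h : IsOrdinalRF G (Ordinal.omega0 * α)) :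
    iterCore G α = ⊥ := by
  obtain ⟨F, hF, hα⟩ := isOrdinalRF_iff.1 h
  exact eq_bot_iff.2 (hα ▸ hF.iterCore_le α)

theorem IsOrdinalRF.finite_iterCore {α : Ordinal.{w}} {n : ℕ}
    (h : IsOrdinalRF G (Ordinal.omega0 * α + n)) : Finite (iterCore G α) := by
  obtain ⟨F, hF, hα⟩ := isOrdinalRF_iff.1 h
  have h1 := hF.add_natCast (Ordinal.omega0 * α) n
  rw [hα, Subgroup.relIndex_bot_left] at h1
  have := Nat.finite_of_card_ne_zero h1
  exact Finite.of_injective _ (Subgroup.inclusion_injective (hF.iterCore_le α))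

/-- In a countable group the residual core is the intersection of a descending sequence of
finite-index subgroups. -/
theorem exists_antitone_iInf_eq_rfCore (G : Type u) [Group G] [Countable G] :
    ∃ M : ℕ → Subgroup G, Antitone M ∧ M 0 = ⊤ ∧ (∀ n, (M n).FiniteIndex) ∧ ⨅ n, M n = rfCore G := by
  obtain ⟨e, he⟩ := exists_surjective_nat G
  have hN : ∀ n, ∃ N : FiniteIndexNormalSubgroup G, e n ∉ rfCore G → e n ∉ N := by
    intro n
    by_cases h : e n ∈ rfCore G
    · exact ⟨⟨⊤, inferInstance, inferInstance⟩, fun h' => (h' h).elim⟩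
    · rw [mem_rfCore] at h
      push Not at h
      obtain ⟨N, hN⟩ := h
      exact ⟨N, fun _ => hN⟩
  choose N hN using hN
  -- The `n`-th term excludes those of the first `n` enumerated elements that lie outside the core.
  refine ⟨fun n => ⨅ k : Fin n, (N k).toSubgroup, fun m n h => ?_, by simp, fun n => ?_, ?_⟩
  · exact le_iInf fun k => iInf_le (fun k : Fin n => (N k).toSubgroup) (Fin.castLE h k)
  · exact Subgroup.finiteIndex_iInf fun k => inferInstance
  · apply le_antisymm
    · intro g hg
      obtain ⟨n, rfl⟩ := he g
      by_contra h
      have h1 := Subgroup.mem_iInf.1 hg (n + 1)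
      exact hN n h (Subgroup.mem_iInf.1 h1 (Fin.last n))
    · exact le_iInf fun n => le_iInf fun k => iInf_le _ _

theorem exists_antitone_iInf_eq_iterCore (G : Type u) [Group G] [Countable G] (α : Ordinal.{w}) :
    ∃ M : ℕ → Subgroup G, Antitone M ∧ M 0 = iterCore G α ∧
      (∀ n, (M n).IsFiniteRelIndex (iterCore G α)) ∧ ⨅ n, M n = iterCore G (α + 1) := by
  obtain ⟨M, h1, h2, h3, h4⟩ := exists_antitone_iInf_eq_rfCore (iterCore G α)
  refine ⟨fun n => (M n).map (iterCore G α).subtype, fun m n h => Subgroup.map_mono (h1 h), ?_,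
    fun n => ?_, ?_⟩
  · simp only [h2, ← MonoidHom.range_eq_map, Subgroup.range_subtype]
  · rw [Subgroup.isFiniteRelIndex_iff_finiteIndex, Subgroup.subgroupOf,
      Subgroup.comap_map_eq_self_of_injective (Subgroup.subtype_injective _)]
    exact h3 n
  · rw [iterCore_add_one, ← h4, Subgroup.map_iInf _ (Subgroup.subtype_injective _)]

/-- In a countable group, `iterCore G α` is the term with index `ω * α` of a chain with finite-index
steps. -/
theorem exists_isFiniteIndexChain (G : Type u) [Group G] [Countable G] :
    ∃ F : Ordinal.{w} → Subgroup G, IsFiniteIndexChain F ∧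
      ∀ α, F (Ordinal.omega0 * α) = iterCore G α := by
  choose M h1 h2 h3 h4 using exists_antitone_iInf_eq_iterCore.{u, w} G
  -- Writing `β = ω * q + n` with `n` finite, the value is the `n`-th term of a sequence descending
  -- from the `q`-th core to the next one.
  let F : Ordinal.{w} → Subgroup G := fun β =>
    M (β / Ordinal.omega0) (Cardinal.toNat (β % Ordinal.omega0).card)
  have hF (α : Ordinal.{w}) (n : ℕ) : F (Ordinal.omega0 * α + n) = M α n := by
    simp only [F]
    rw [Ordinal.mul_add_div _ Ordinal.omega0_ne_zero, Ordinal.mul_add_mod_self,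
      Ordinal.div_eq_zero_of_lt (Ordinal.natCast_lt_omega0 n),
      Ordinal.mod_eq_of_lt (Ordinal.natCast_lt_omega0 n)]
    simp
  have hF0 (α : Ordinal.{w}) : F (Ordinal.omega0 * α) = iterCore G α := by
    rw [← h2, ← hF, Nat.cast_zero, add_zero]
  have hdecomp (β : Ordinal.{w}) : ∃ (α : Ordinal.{w}) (n : ℕ), β = Ordinal.omega0 * α + n := by
    obtain ⟨n, hn⟩ := Ordinal.lt_omega0.1 (Ordinal.mod_lt β Ordinal.omega0_ne_zero)
    exact ⟨β / Ordinal.omega0, n, by rw [← hn, Ordinal.div_add_mod]⟩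
  have hanti : Antitone F := by
    intro β γ h
    have hq := Ordinal.div_le_left h Ordinal.omega0
    obtain ⟨p, m, rfl⟩ := hdecomp β
    obtain ⟨q, n, rfl⟩ := hdecomp γ
    simp only [Ordinal.mul_add_div _ Ordinal.omega0_ne_zero,
      Ordinal.div_eq_zero_of_lt (Ordinal.natCast_lt_omega0 _), add_zero] at hq
    rw [hF, hF]
    rcases hq.eq_or_lt with rfl | hq
    · exact h1 _ (by simpa using h)
    · calc M q n ≤ M q 0 := h1 q (Nat.zero_le n)
        _ = iterCore G q := h2 q
        _ ≤ iterCore G (p + 1) := iterCore_antitone (Order.add_one_le_of_lt hq)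
        _ = ⨅ n, M p n := (h4 p).symm
        _ ≤ M p m := iInf_le _ _
  refine ⟨F, ⟨hanti, ?_, fun β => ?_, fun l hl => ?_⟩, hF0⟩
  · rw [← mul_zero Ordinal.omega0, hF0, iterCore_zero]
  · obtain ⟨q, n, rfl⟩ := hdecomp β
    have e : Ordinal.omega0 * q + n + 1 = Ordinal.omega0 * q + (n + 1 : ℕ) := by
      rw [Nat.cast_succ, add_assoc]
    rw [e, hF, hF]
    have := h3 q (n + 1)
    exact Subgroup.isFiniteRelIndex_of_le_right _ ((h1 q (Nat.zero_le n)).trans_eq (h2 q))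
  · refine le_antisymm (le_iInf₂ fun β hβ => hanti hβ.le) ?_
    obtain ⟨q, rfl⟩ := Ordinal.isSuccPrelimit_iff_omega0_dvd.1 hl.isSuccPrelimit
    rw [hF0]
    have hq0 : q ≠ 0 := by rintro rfl; simp at hl
    induction q using Ordinal.limitRecOn with
    | zero => exact (hq0 rfl).elim
    | add_one p _ =>
      rw [← h4]
      refine le_iInf fun n => (iInf₂_le (Ordinal.omega0 * p + n) ?_).trans_eq (hF p n)
      rw [mul_add_one]
      exact add_lt_add_right (Ordinal.natCast_lt_omega0 n) _
    | limit q hq _ =>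
      rw [iterCore_limit hq]
      refine le_iInf₂ fun p hp => (iInf₂_le (Ordinal.omega0 * p) ?_).trans_eq (hF0 p)
      exact mul_lt_mul_of_pos_left hp Ordinal.omega0_pos

theorem isOrdinalRF_omega0_mul_iff [Countable G] {α : Ordinal.{w}} :
    IsOrdinalRF G (Ordinal.omega0 * α) ↔ iterCore G α = ⊥ := by
  refine ⟨IsOrdinalRF.iterCore_eq_bot, fun h => ?_⟩
  obtain ⟨F, hF, hα⟩ := exists_isFiniteIndexChain.{u, w} G
  exact isOrdinalRF_iff.2 ⟨F, hF, (hα α).trans h⟩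

end Chains

/-! ### Infinitude of normal subgroups meeting a factor -/

section Infinite

variable {Γ : Type u} [Group Γ] {ι : Type v} {A : ι → Subgroup Γ}

theorem pow_mul_conj_ne_one {G : ι → Type w} [∀ i, Group (G i)] {i j : ι} (hij : i ≠ j) {c : G i}
    {b : G j} (hc : c ≠ 1) (hb : b ≠ 1) (n : ℕ) :
    (CoprodI.of c * (CoprodI.of b * CoprodI.of c * (CoprodI.of b)⁻¹)) ^ (n + 1) ≠ 1 := by
  -- The word `c b c b⁻¹` starts in factor `i` and ends in factor `j`, so its powers concatenate
  -- without cancellation.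
  let x : CoprodI.NeWord G i j := .append (.singleton c hc) hij (.append (.singleton b hb) hij.symm
    (.append (.singleton c hc) hij (.singleton b⁻¹ (inv_ne_one.2 hb))))
  have key : ∃ y : CoprodI.NeWord G i j, y.prod =
      (CoprodI.of c * (CoprodI.of b * CoprodI.of c * (CoprodI.of b)⁻¹)) ^ (n + 1) := by
    induction n with
    | zero => exact ⟨x, by simp [x, mul_assoc]⟩
    | succ n ih =>
      obtain ⟨y, hy⟩ := ih
      exact ⟨.append y hij.symm x, by
        rw [pow_succ _ (n + 1), CoprodI.NeWord.append_prod, hy]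
        simp [x, mul_assoc]⟩
  obtain ⟨y, hy⟩ := key
  rw [← hy]
  exact prod_word_ne_one fun h => y.toList_ne_nil (congrArg CoprodI.Word.toList h)

/-- A normal subgroup of a nontrivial free product meeting a factor nontrivially is infinite. -/
theorem infinite_of_inf_ne_bot [Nontrivial ι] (hA : ∀ i, A i ≠ ⊥) (hfree : IsFreeProductOf A)
    {N : Subgroup Γ} [N.Normal] {i : ι} (hi : A i ⊓ N ≠ ⊥) : Infinite N := by
  obtain ⟨j, hj⟩ := exists_ne i
  obtain ⟨⟨c, hc⟩, hc1⟩ := Subgroup.ne_bot_iff_exists_ne_one.1 hi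
  obtain ⟨b, hb⟩ := Subgroup.ne_bot_iff_exists_ne_one.1 (hA j)
  by_contra hfin
  rw [not_infinite_iff_finite] at hfin
  have hx : (c : Γ) * (b * c * (b : Γ)⁻¹) ∈ N :=
    N.mul_mem hc.2 (Subgroup.Normal.conj_mem inferInstance _ hc.2 _)
  obtain ⟨n, hn, h⟩ := isOfFinOrder_iff_pow_eq_one.1 (isOfFinOrder_of_finite (⟨_, hx⟩ : N))
  obtain ⟨m, rfl⟩ := Nat.exists_eq_succ_of_ne_zero hn.ne'
  refine pow_mul_conj_ne_one (G := fun i => A i) hj.symm (c := ⟨c, hc.1⟩) (b := b)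
    (fun h => hc1 (Subtype.ext (congrArg (fun x : A i => (x : Γ)) h))) hb m (hfree.1 ?_)
  have h' := congrArg Subtype.val h
  simpa using h'

end Infinite

/-! ### Depth of the free product -/

section Depth

variable {Γ : Type u} [Group Γ] [Countable Γ] {ι : Type v} {A : ι → Subgroup Γ}
  {d : ι → Ordinal.{w}} {σ : Ordinal.{w}}

theorem hasRFDepth_of_isSuccLimit (hfree : IsFreeProductOf A) (hd : ∀ i, HasRFDepth (A i) (d i))
    (hσ : IsLUB (Set.range d) σ) (hlim : Order.IsSuccLimit σ) : HasRFDepth Γ σ := by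
  obtain ⟨α, rfl⟩ := Ordinal.isSuccPrelimit_iff_omega0_dvd.1 hlim.isSuccPrelimit
  constructor
  · exact isOrdinalRF_omega0_mul_iff.2 (iterCore_eq_bot hfree fun i =>
      ((hd i).1.mono (hσ.1 ⟨i, rfl⟩)).iterCore_eq_bot)
  · rintro β hβ
    refine hσ.2 ?_
    rintro _ ⟨i, rfl⟩
    exact (hd i).2 (IsOrdinalRF.subgroup hβ (A i))

theorem hasRFDepth_of_eq_add_one [Nontrivial ι] (hA : ∀ i, A i ≠ ⊥) (hfree : IsFreeProductOf A)
    (hd : ∀ i, HasRFDepth (A i) (d i)) (hσ : IsLUB (Set.range d) σ) {τ : Ordinal.{w}}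
    (hτ : σ = τ + 1) : HasRFDepth Γ (σ + Ordinal.omega0) := by
  obtain ⟨m, hm⟩ := Ordinal.lt_omega0.1 (Ordinal.mod_lt τ Ordinal.omega0_ne_zero)
  have hτα := Ordinal.div_add_mod τ Ordinal.omega0
  rw [hm] at hτα
  set α := τ / Ordinal.omega0
  -- The finite remainder `m + 1` is absorbed by the added `ω`.
  have hsum : σ + Ordinal.omega0 = Ordinal.omega0 * (α + 1) := by
    rw [hτ, ← hτα, mul_add_one, add_assoc, add_assoc, Ordinal.one_add_omega0,
      Ordinal.natCast_add_omega0]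
  constructor
  · rw [hsum]
    refine isOrdinalRF_omega0_mul_iff.2 (iterCore_eq_bot hfree fun i => ?_)
    refine ((hd i).1.mono ((hσ.1 ⟨i, rfl⟩).trans ?_)).iterCore_eq_bot
    rw [← hsum]
    exact le_self_add
  · intro β hβ
    by_contra! hlt
    rw [hsum, mul_add_one] at hlt
    obtain ⟨γ, hγ, hle⟩ := (Ordinal.lt_add_iff Ordinal.omega0_ne_zero).1 hlt
    obtain ⟨n, rfl⟩ := Ordinal.lt_omega0.1 hγ
    have hfin := (IsOrdinalRF.mono hβ hle).finite_iterCore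
    -- As `τ < σ`, it is not an upper bound of the depths.
    obtain ⟨i, hi⟩ : ∃ i, τ < d i := by
      by_contra! hc
      have h := hσ.2 (show τ ∈ upperBounds (Set.range d) by rintro _ ⟨i, rfl⟩; exact hc i)
      rw [hτ] at h
      exact (Order.lt_add_one_iff.2 le_rfl).not_ge h
    -- A trivial core here would give `d i ≤ ω * α ≤ τ`.
    have hne : iterCore (A i) α ≠ ⊥ := fun h => by
      refine hi.not_ge (((hd i).2 (isOrdinalRF_omega0_mul_iff.2 h)).trans ?_)
      rw [← hτα]
      exact le_self_add
    have : A i ⊓ iterCore Γ α ≠ ⊥ := by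
      rw [inf_iterCore_eq hfree, Ne, Subgroup.map_eq_bot_iff_of_injective _
        (Subgroup.subtype_injective _)]
      exact hne
    exact not_finite_iff_infinite.2 (infinite_of_inf_ne_bot hA hfree this) hfin

end Depth

theorem lemma1p4 {Γ : Type u} [Group Γ] [Countable Γ] {ι : Type v} (A : ι → Subgroup Γ)
    (hA : ∀ i, A i ≠ ⊥) (hfree : IsFreeProductOf A) :
    (∀ (α : Ordinal.{w}) (i : ι),
      A i ⊓ iterCore Γ α = (iterCore (A i) α).map (A i).subtype) ∧
    (∀ α : Ordinal.{w}, ∃ (J : Type (max u v)) (f : J → ι) (B : J → Subgroup (iterCore Γ α)),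
      Function.Surjective f ∧ IsFreeProductOf B ∧
      ∀ j, Nonempty (B j ≃* iterCore (A (f j)) α)) ∧
    (∀ (d : ι → Ordinal.{w}) (σ : Ordinal.{w}),
      (∀ i, HasRFDepth (A i) (d i)) → IsLUB (Set.range d) σ →
      (Order.IsSuccLimit σ → HasRFDepth Γ σ) ∧
      (Nontrivial ι → (∃ τ : Ordinal.{w}, σ = τ + 1) →
        HasRFDepth Γ (σ + Ordinal.omega0.{w}))) :=
  ⟨inf_iterCore_eq hfree, iterCore_isFreeProductOf hfree, fun _ _ hd hσ =>
    ⟨hasRFDepth_of_isSuccLimit hfree hd hσ, fun _ ⟨_, hτ⟩ =>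
      hasRFDepth_of_eq_add_one hA hfree hd hσ hτ⟩⟩
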